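/- Let $G$ be a finite simple graph with vertex set $\{t_1,\ldots,t_s\}$ and let $D$ be a weighted oriented graph with underlying graph $G$; that is, $D$ is obtained from $G$ by assigning to each edge one direction and to each vertex $t_i$ a weight $w_i\in\{1,2,3,\ldots\}$. A source (respectively, sink) is a vertex with only outgoing (respectively, only incoming) edges; assume that $w_i=1$ whenever $t_i$ is a source. Let $K$ be a field, let $S=K[t_1,\ldots,t_s]$, and let $$I=I(D)=\bigl(t_it_j^{w_j}\mid (t_i,t_j)\text{ is an edge of }D\text{ directed from }t_i\text{ to }t_j\bigr)\subset S$$ be the edge ideal of $D$. For an ideal $L$ of $S$ let $\mathrm{Ass}(L)$ be the set of prime ideals of the form $(L\colon f)$ with $f\in S$. For $n\ge 1$ let $$I^{(n)}=\bigcap_{\mathfrak p}\,(I^nS_{\mathfrak p}\cap S),$$ where $\mathfrak p$ runs through the minimal primes of $I$, be the $n$-th symbolic power of $I$. Suppose that $I$ has no embedded primes, i.e., no element of $\mathrm{Ass}(I)$ properly contains another element of $\mathrm{Ass}(I)$. Then the following conditions are equivalent: (a) $\mathrm{Ass}(I^n)=\mathrm{Ass}(I)$ for all $n\ge 1$, i.e.,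 $I$ is normally torsion-free; (b) $I^n=I^{(n)}$ for all $n\ge 1$; (c) every vertex $t_i$ with $w_i>1$ is a sink, and $G$ is bipartite. -/

import Mathlib

/-- A weighted oriented graph on the vertex set `V`: a digraph in which no edge occurs together with
its reverse (in particular there are no loops), with a positive integer weight at every vertex.
`D.Adj u v` means that `(u, v)` is an edge of `D`. -/
structure WeightedOrientedGraph (V : Type*) extends Digraph V where
  asymm : ∀ u v : V, Adj u v → ¬ Adj v u
  weight : V → ℕ
  weight_pos : ∀ v : V, 0 < weight v

namespace WeightedOrientedGraph

variable {V : Type*}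

/-- The underlying simple graph of `D`. -/
def underlyingGraph (D : WeightedOrientedGraph V) : SimpleGraph V :=
  D.toDigraph.toSimpleGraphInclusive

/-- A source: a vertex with only outgoing edges. -/
def IsSource (D : WeightedOrientedGraph V) (v : V) : Prop :=
  ∀ u : V, ¬ D.Adj u v

/-- A sink: a vertex with only incoming edges. -/
def IsSink (D : WeightedOrientedGraph V) (v : V) : Prop :=
  ∀ u : V, ¬ D.Adj v u

/-- The edge ideal `I(D)` of `K[t_v : v ∈ V]`, generated by the monomials `t_u * t_v ^ w(v)`,
where `(u, v)` runs through the edges of `D`. -/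
noncomputable def edgeIdeal (K : Type*) [Field K] (D : WeightedOrientedGraph V) :
    Ideal (MvPolynomial V K) :=
  Ideal.span {f | ∃ u v : V, D.Adj u v ∧
    f = MvPolynomial.X u * MvPolynomial.X v ^ D.weight v}

end WeightedOrientedGraph

namespace Ideal

variable {R : Type*} [CommRing R]

/-- The embedded primes of `I`: the associated primes of `I` that properly contain another
associated prime of `I`. -/
def embeddedPrimes (I : Ideal R) : Set (Ideal R) :=
  {p | p ∈ Submodule.associatedPrimes I ∧ ∃ q ∈ Submodule.associatedPrimes I, q < p}

/-- `I` is normally torsion-free if `Ass(I ^ n) = Ass(I)` for all `n ≥ 1`. -/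
def IsNormallyTorsionFree (I : Ideal R) : Prop :=
  ∀ n : ℕ, 1 ≤ n → Submodule.associatedPrimes (I ^ n) = Submodule.associatedPrimes I

/-- The contraction `I R_p ∩ R` to `R` of the extension of `I` to the localization at `p`. -/
def localizationContraction (I p : Ideal R) [p.IsPrime] : Ideal R :=
  (I.map (algebraMap R (Localization.AtPrime p))).comap (algebraMap R (Localization.AtPrime p))

/-- The `n`-th symbolic power of `I` (defined through the minimal primes of `I`): the intersection
of the ideals `I ^ n R_p ∩ R`, where `p` runs through the minimal primes of `I`. -/
def minimalSymbolicPower (I : Ideal R) (n : ℕ) : Ideal R :=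
  ⨅ (p : Ideal R) (hp : p ∈ I.minimalPrimes),
    haveI : p.IsPrime := hp.1.1
    (I ^ n).localizationContraction p

end Ideal

/-! Without embedded primes, Ass(I) = Min(I), and (a) ⇔ (b) is a general fact about Noetherian
rings.

(b) ⇒ (c): explicit monomials separate `I^(n)` from `I^n`. If `w_v > 1` and `v` is not a sink, then
`v` is not a source either, so there is a path `u → v → x`, and `t_u t_v^w t_x^(y(w-1))`, with `w`,
`y` the weights of `v`, `x`, lies in `I^(w)` but not in `I^w`. Once all such `v` are sinks, the
product of the `t_i^(w_i)` along a closed walk of length `2k+1` lies in `I^(k+1)`, since a vertex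
cover meets at least half of the walk, but not in the ordinary power. A grading in which all
generators of `I` have large degree proves each non-membership (`le_weight_of_mem_edgeIdeal_pow`).

(c) ⇒ (b): tails of edges have weight 1, so the generators are `t_u^(w_u) t_v^(w_v)`. If `t^m`
occurs in an element of `I^(n)`, every vertex cover `C` satisfies `n ≤ ∑_{v ∈ C} ⌊m_v / w_v⌋`. The
weighted König theorem with capacities `⌊m_v / w_v⌋` then yields `n` edges whose generators multiply
to a divisor of `t^m`. -/

namespace Ideal

/-! ### Associated primes and symbolic powers in Noetherian rings. -/

variable {R : Type*} [CommRing R]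

theorem mem_localizationContraction {I p : Ideal R} [p.IsPrime] {f : R} :
    f ∈ I.localizationContraction p ↔ ∃ s ∉ p, s * f ∈ I := by
  rw [localizationContraction, Ideal.mem_comap,
    IsLocalization.algebraMap_mem_map_algebraMap_iff p.primeCompl]
  rfl

theorem mem_minimalSymbolicPower {I : Ideal R} {n : ℕ} {f : R} :
    f ∈ I.minimalSymbolicPower n ↔ ∀ p ∈ I.minimalPrimes, ∃ s ∉ p, s * f ∈ I ^ n := by
  simp only [minimalSymbolicPower, Submodule.mem_iInf]
  refine forall₂_congr fun p hp => ?_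
  have : p.IsPrime := hp.1.1
  exact mem_localizationContraction

theorem pow_le_minimalSymbolicPower (I : Ideal R) (n : ℕ) :
    I ^ n ≤ I.minimalSymbolicPower n := fun f hf =>
  mem_minimalSymbolicPower.2 fun p hp =>
    ⟨1, fun h => hp.1.1.ne_top ((Ideal.eq_top_iff_one p).2 h), by simpa using hf⟩

theorem minimalPrimes_subset_submodule_associatedPrimes [IsNoetherianRing R] (I : Ideal R) :
    I.minimalPrimes ⊆ Submodule.associatedPrimes I := by
  intro p hp
  have hc : Submodule.colon I {(1 : R)} = I := by
    ext r
    simp [Submodule.mem_colon_singleton]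
  obtain ⟨x, hx⟩ := Submodule.exists_eq_colon_of_mem_minimalPrimes (N := I) (x := (1 : R))
    (I := p) (by rwa [hc])
  exact Submodule.isAssociatedPrime_iff.2 ⟨hp.1.1, x, hx⟩

theorem le_of_mem_submodule_associatedPrimes [IsNoetherianRing R] {I p : Ideal R}
    (hp : p ∈ Submodule.associatedPrimes I) : I ≤ p := by
  obtain ⟨-, x, rfl⟩ := Submodule.isAssociatedPrime_iff.1 hp
  intro r hr
  rw [Submodule.mem_colon_singleton]
  exact I.mul_mem_right x hr

theorem associatedPrimes_eq_minimalPrimes_of_embeddedPrimes_eq_empty [IsNoetherianRing R]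
    {I : Ideal R} (h : I.embeddedPrimes = ∅) :
    Submodule.associatedPrimes I = I.minimalPrimes := by
  refine subset_antisymm (fun p hp => ?_) I.minimalPrimes_subset_submodule_associatedPrimes
  have : p.IsPrime := hp.1
  obtain ⟨q, hq, hqp⟩ := Ideal.exists_minimalPrimes_le (le_of_mem_submodule_associatedPrimes hp)
  obtain rfl | hlt := eq_or_lt_of_le hqp
  · exact hq
  · have : p ∈ I.embeddedPrimes :=
      ⟨hp, q, I.minimalPrimes_subset_submodule_associatedPrimes hq, hlt⟩
    simp [h] at this

/-- A minimal prime over the proper ideal `(I : f)` is associated to `I`. -/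
theorem exists_mem_submodule_associatedPrimes_of_notMem [IsNoetherianRing R] {I : Ideal R} {f : R}
    (hf : f ∉ I) : ∃ p ∈ Submodule.associatedPrimes I, ∀ s, s * f ∈ I → s ∈ p := by
  have hne : Submodule.colon I {f} ≠ ⊤ := by
    intro h
    have h1 : (1 : R) ∈ Submodule.colon I {f} := h ▸ Submodule.mem_top
    rw [Submodule.mem_colon_singleton, one_smul] at h1
    exact hf h1
  obtain ⟨m, hm, hle⟩ := Ideal.exists_le_maximal _ hne
  have := hm.isPrime
  obtain ⟨p, hp, -⟩ := Ideal.exists_minimalPrimes_le hle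
  obtain ⟨x, hx⟩ := Submodule.exists_eq_colon_of_mem_minimalPrimes hp
  refine ⟨p, Submodule.isAssociatedPrime_iff.2 ⟨hp.1.1, x, hx⟩, fun s hs => hp.1.2 ?_⟩
  rwa [Submodule.mem_colon_singleton]

theorem isNormallyTorsionFree_iff_pow_eq_minimalSymbolicPower [IsNoetherianRing R] {I : Ideal R}
    (h : I.embeddedPrimes = ∅) :
    I.IsNormallyTorsionFree ↔ ∀ n : ℕ, 1 ≤ n → I ^ n = I.minimalSymbolicPower n := by
  have hmin := associatedPrimes_eq_minimalPrimes_of_embeddedPrimes_eq_empty h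
  refine forall₂_congr fun n hn => ?_
  rw [hmin]
  refine ⟨fun hn' => le_antisymm (I.pow_le_minimalSymbolicPower n) fun f hf => ?_, fun hI => ?_⟩
  · by_contra hfn
    obtain ⟨p, hp, hsub⟩ := exists_mem_submodule_associatedPrimes_of_notMem hfn
    obtain ⟨s, hs, hsf⟩ := mem_minimalSymbolicPower.1 hf p (hn' ▸ hp)
    exact hs (hsub s hsf)
  · refine subset_antisymm (fun p hp => ?_) ?_
    · obtain ⟨hpp, f, hf⟩ := Submodule.isAssociatedPrime_iff.1 hp
      have hIp : I ≤ p :=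
        hpp.le_of_pow_le (le_of_mem_submodule_associatedPrimes hp)
      have hfn : f ∉ I.minimalSymbolicPower n := by
        rw [← hI]
        intro hfI
        apply hpp.ne_top
        rw [hf, Ideal.eq_top_iff_one, Submodule.mem_colon_singleton, one_smul]
        exact hfI
      rw [mem_minimalSymbolicPower] at hfn
      push Not at hfn
      obtain ⟨q, hq, hqf⟩ := hfn
      -- No element outside `q` multiplies `f` into `I ^ n`, so `p = (I ^ n : f)` lies in `q`;
      -- minimality of `q` forces `p = q`.
      have hpq : p ≤ q := by
        intro s hs
        by_contra hsq
        refine hqf s hsq ?_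
        rwa [hf, Submodule.mem_colon_singleton] at hs
      rwa [le_antisymm hpq (hq.2 ⟨hpp, hIp⟩ hpq)]
    · have := (I ^ n).minimalPrimes_subset_submodule_associatedPrimes
      rwa [← Ideal.radical_minimalPrimes, Ideal.radical_pow I (by omega),
        Ideal.radical_minimalPrimes] at this

end Ideal

/-! ### Ideals generated by variables, and saturation. -/

namespace MvPolynomial

variable {σ K : Type*} [Field K]

/-- The ideal is the kernel of the substitution that kills the variables in `C`, whose target is a
domain. -/
theorem isPrime_span_X_image (C : Set σ) :
    (Ideal.span (X '' C : Set (MvPolynomial σ K))).IsPrime := by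
  classical
  set J := Ideal.span (X '' C : Set (MvPolynomial σ K)) with hJ
  let φ : MvPolynomial σ K →ₐ[K] MvPolynomial σ K := aeval fun i => if i ∈ C then 0 else X i
  have hφ : ∀ p, Ideal.Quotient.mk J (φ p) = Ideal.Quotient.mk J p := by
    have : (Ideal.Quotient.mkₐ K J).comp φ = Ideal.Quotient.mkₐ K J := by
      ext i
      by_cases hi : i ∈ C
      · have : X i ∈ J := Ideal.subset_span ⟨i, hi, rfl⟩
        simpa [φ, hi] using (Ideal.Quotient.eq_zero_iff_mem.2 this).symm
      · simp [φ, hi]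
    exact fun p => DFunLike.congr_fun this p
  have hker : J = RingHom.ker φ := by
    refine le_antisymm (Ideal.span_le.2 ?_) fun p hp => ?_
    · rintro _ ⟨i, hi, rfl⟩
      simp [φ, hi]
    · rw [← Ideal.Quotient.eq_zero_iff_mem, ← hφ, RingHom.mem_ker.1 hp, map_zero]
  rw [hker]
  exact RingHom.ker_isPrime _

theorem exists_coeff_eq_ite (f : MvPolynomial σ K) (p : (σ →₀ ℕ) → Prop) [DecidablePred p] :
    ∃ g : MvPolynomial σ K, ∀ m, coeff m g = if p m then coeff m f else 0 := by
  classical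
  refine ⟨∑ m ∈ f.support with p m, monomial m (coeff m f), fun m => ?_⟩
  simp only [coeff_sum, coeff_monomial, Finset.sum_ite_eq', Finset.mem_filter, mem_support_iff]
  by_cases h : coeff m f = 0 <;> simp [h]

/-- A monomial ideal whose exponents are characterized by a monotone condition on the variables
in `C` is saturated with respect to polynomials with a monomial free of the variables in `C`. -/
theorem forall_mem_support_of_mul {C : Set σ} [DecidablePred (· ∈ C)]
    {P : (σ →₀ ℕ) → Prop} (hP : Monotone P)
    {s f : MvPolynomial σ K} (hs : ∃ x ∈ s.support, ∀ i ∈ C, x i = 0)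
    (h : ∀ k ∈ (s * f).support, P (k.filter (· ∈ C))) :
    ∀ y ∈ f.support, P (y.filter (· ∈ C)) := by
  classical
  by_contra! hc
  let π : (σ →₀ ℕ) → σ →₀ ℕ := fun m => m.filter (· ∈ C)
  have hπ : ∀ a b, π (a + b) = π a + π b := fun a b => Finsupp.filter_add
  obtain ⟨y₀, hy₀, hmin⟩ := Finset.exists_min_image (f.support.filter fun y => ¬ P (π y))
    (fun y => (π y).degree) (by obtain ⟨y, hy⟩ := hc; exact ⟨y, Finset.mem_filter.2 hy⟩)
  -- Here `y₀` is a bad exponent of least degree in `C`. Below, `s₀` is the part of `s` free of `C`,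
  -- and `f₀` the part of `f` with the same `C`-exponent as `y₀`.
  rw [Finset.mem_filter] at hy₀
  obtain ⟨x₀, hx₀, hx₀C⟩ := hs
  obtain ⟨s₀, hs₀⟩ := exists_coeff_eq_ite s fun x => π x = 0
  obtain ⟨f₀, hf₀⟩ := exists_coeff_eq_ite f fun y => π y = π y₀
  have hs₀0 : s₀ ≠ 0 := by
    intro h0
    have hπx : π x₀ = 0 := by
      ext i
      by_cases hi : i ∈ C <;> simp [π, hi, hx₀C]
    have := hs₀ x₀
    rw [if_pos hπx, h0, coeff_zero] at this
    exact mem_support_iff.1 hx₀ this.symm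
  have hf₀0 : f₀ ≠ 0 := by
    intro h0
    have := hf₀ y₀
    rw [if_pos rfl, h0, coeff_zero] at this
    exact mem_support_iff.1 hy₀.1 this.symm
  obtain ⟨k, hk⟩ := ne_zero_iff.1 (mul_ne_zero hs₀0 hf₀0)
  have hkπ : π k = π y₀ := by
    rw [coeff_mul] at hk
    obtain ⟨⟨a, b⟩, hab, hne⟩ := Finset.exists_ne_zero_of_sum_ne_zero hk
    rw [Finset.HasAntidiagonal.mem_antidiagonal] at hab
    simp only at hab hne
    rw [hs₀, hf₀] at hne
    have ha : π a = 0 := by by_contra ha; simp [ha] at hne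
    have hb : π b = π y₀ := by by_contra hb; simp [hb] at hne
    rw [← hab, hπ, ha, hb, zero_add]
  have hcoeff : coeff k (s * f) = coeff k (s₀ * f₀) := by
    rw [coeff_mul, coeff_mul]
    refine Finset.sum_congr rfl ?_
    rintro ⟨a, b⟩ hab
    rw [Finset.HasAntidiagonal.mem_antidiagonal] at hab
    simp only at hab
    simp only [hs₀, hf₀]
    have hsum : π a + π b = π y₀ := by rw [← hπ, hab, hkπ]
    by_cases ha : π a = 0
    · have hb : π b = π y₀ := by rw [← hsum, ha, zero_add]
      simp [ha, hb]
    -- A nonzero `π a` leaves a smaller `π b`, again bad by monotonicity, which contradicts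
    -- minimality; so nothing cancels the terms of `s₀ * f₀`.
    · have hb0 : coeff b f = 0 := by
        by_contra hb0
        have hbP : ¬ P (π b) := fun hPb =>
          hy₀.2 (hP (by rw [← hsum]; exact le_add_self) hPb)
        have hle := hmin b (Finset.mem_filter.2 ⟨mem_support_iff.2 hb0, hbP⟩)
        rw [← hsum, map_add] at hle
        exact ha ((Finsupp.degree_eq_zero_iff _).1 (by omega))
      simp [ha, hb0]
  refine hy₀.2 ?_
  have := h k (mem_support_iff.2 (hcoeff ▸ hk))
  change P (π k) at this
  rwa [hkπ] at this

end MvPolynomial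

/-! ### Weighted König theorem and vertex covers of closed walks. -/

namespace SimpleGraph

variable {V : Type*} [Fintype V]

/-- The weighted form of König's theorem: in a bipartite graph with capacities `a` on the vertices
in which every vertex cover has capacity at least `n`, there are `n` edges (with repetitions) such
that every vertex `v` is used at most `a v` times. -/
theorem IsBipartite.exists_edges_of_forall_le_sum_cover [DecidableEq V] {G : SimpleGraph V}
    (hG : G.IsBipartite) (a : V → ℕ) (n : ℕ)
    (h : ∀ C : Finset V, (∀ u v, G.Adj u v → u ∈ C ∨ v ∈ C) → n ≤ ∑ v ∈ C, a v) :
    ∃ p q : Fin n → V, (∀ i, G.Adj (p i) (q i)) ∧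
      ∀ v, Finset.card {i | p i = v} + Finset.card {i | q i = v} ≤ a v := by
  classical
  obtain ⟨c⟩ := hG
  obtain ⟨C, hC, hmin⟩ := Finset.exists_min_image
    (Finset.univ.filter fun C : Finset V => ∀ u v, G.Adj u v → u ∈ C ∨ v ∈ C)
    (fun C => ∑ v ∈ C, a v) ⟨Finset.univ, by simp⟩
  replace hC := (Finset.mem_filter.1 hC).2
  let N : Finset V → Finset V := fun X => {u | u ∉ C ∧ ∃ x ∈ X, G.Adj x u}
  -- A monochromatic `X` is independent, so exchanging it for `N X` in the cheapest cover `C` gives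
  -- another cover.
  have hmono : ∀ X ⊆ C, ∀ b, (∀ x ∈ X, c x = b) → ∑ v ∈ X, a v ≤ ∑ v ∈ N X, a v := by
    intro X hX b hb
    have hcov := hmin (C \ X ∪ N X) (Finset.mem_filter.2 ⟨Finset.mem_univ _, by
      have key : ∀ u v, G.Adj u v → u ∈ C → u ∈ C \ X ∪ N X ∨ v ∈ C \ X ∪ N X := by
        intro u v huv hu
        by_cases hux : u ∈ X
        · right
          by_cases hv : v ∈ C
          · refine Finset.mem_union_left _ (Finset.mem_sdiff.2 ⟨hv, fun hvx => ?_⟩)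
            exact c.valid huv ((hb u hux).trans (hb v hvx).symm)
          · exact Finset.mem_union_right _ (by simpa [N] using ⟨hv, u, hux, huv⟩)
        · exact Or.inl (Finset.mem_union_left _ (Finset.mem_sdiff.2 ⟨hu, hux⟩))
      intro u v huv
      rcases hC u v huv with hu | hv
      · exact key u v huv hu
      · exact (key v u huv.symm hv).symm⟩)
    have h1 := Finset.sum_union_inter (s₁ := C \ X) (s₂ := N X) (f := a)
    have h2 := Finset.sum_sdiff hX (f := a)
    omega
  -- The two colour classes of `X` have their neighbours in opposite classes, so these bounds add up
  -- without overlap.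
  have hall : ∀ X ⊆ C, ∑ v ∈ X, a v ≤ ∑ v ∈ N X, a v := by
    intro X hX
    rw [← Finset.sum_filter_add_sum_filter_not X (fun x => c x = 0),
      ← Finset.sum_filter_add_sum_filter_not (N X) (fun x => ¬ c x = 0)]
    refine add_le_add ?_ ?_
    · refine (hmono _ ((Finset.filter_subset _ _).trans hX) 0 (by simp)).trans
        (Finset.sum_le_sum_of_subset fun u hu => ?_)
      simp only [N, Finset.mem_filter, Finset.mem_univ, true_and] at hu ⊢
      obtain ⟨hu, x, ⟨hx, hx0⟩, hxu⟩ := hu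
      exact ⟨⟨hu, x, hx, hxu⟩, fun h0 => c.valid hxu (hx0.trans h0.symm)⟩
    · refine (hmono _ ((Finset.filter_subset _ _).trans hX) 1 (by simp; omega)).trans
        (Finset.sum_le_sum_of_subset fun u hu => ?_)
      simp only [N, Finset.mem_filter, Finset.mem_univ, true_and] at hu ⊢
      obtain ⟨hu, x, ⟨hx, hx0⟩, hxu⟩ := hu
      have := c.valid hxu
      exact ⟨⟨hu, x, hx, hxu⟩, by omega⟩
  -- Replace each `v` by `a v` copies: Hall's theorem matches all copies over `C` injectively to
  -- copies of neighbours outside `C`.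
  let ι := {x : Σ v, Fin (a v) // x.1 ∈ C}
  let r : ι → (Σ v, Fin (a v)) → Prop := fun x y => y.1 ∉ C ∧ G.Adj x.1.1 y.1
  obtain ⟨f, hf, hfr⟩ := (Fintype.all_card_le_filter_rel_iff_exists_injective r).1 (by
    intro A
    let X : Finset V := A.image fun x => x.1.1
    have hX : X ⊆ C := by
      intro v hv
      obtain ⟨x, -, rfl⟩ := Finset.mem_image.1 hv
      exact x.2
    calc A.card = (A.map (Function.Embedding.subtype _)).card := (Finset.card_map _).symm
      _ ≤ (X.sigma fun _ => Finset.univ).card := Finset.card_le_card fun y hy => by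
          obtain ⟨x, hx, rfl⟩ := Finset.mem_map.1 hy
          exact Finset.mem_sigma.2 ⟨Finset.mem_image.2 ⟨x, hx, rfl⟩, Finset.mem_univ _⟩
      _ = ∑ v ∈ X, a v := by simp [Finset.card_sigma]
      _ ≤ ∑ v ∈ N X, a v := hall X hX
      _ = ((N X).sigma fun v => (Finset.univ : Finset (Fin (a v)))).card := by
          simp [Finset.card_sigma]
      _ ≤ _ := Finset.card_le_card fun y hy => by
          simp only [N, X, Finset.mem_sigma, Finset.mem_filter, Finset.mem_univ, true_and,
            and_true, Finset.mem_image] at hy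
          obtain ⟨hy, _, ⟨x, hx, rfl⟩, hadj⟩ := hy
          exact Finset.mem_filter.2 ⟨Finset.mem_univ _, x, hx, hy, hadj⟩)
  have hcard : Fintype.card (Fin n) ≤ Fintype.card ι := by
    have : Fintype.card ι = (C.sigma fun v => (Finset.univ : Finset (Fin (a v)))).card :=
      Fintype.card_of_subtype _ (by simp)
    rw [this, Finset.card_sigma, Fintype.card_fin]
    simpa using h C hC
  obtain ⟨e⟩ := Function.Embedding.nonempty_of_card_le hcard
  have hfib : ∀ (g : Fin n → Σ v, Fin (a v)), Function.Injective g → ∀ v,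
      Finset.card {i | (g i).1 = v} ≤ a v := by
    intro g hg v
    calc Finset.card {i | (g i).1 = v}
        = (Finset.image g {i | (g i).1 = v}).card := (Finset.card_image_of_injective _ hg).symm
      _ ≤ (({v} : Finset V).sigma fun v => (Finset.univ : Finset (Fin (a v)))).card :=
          Finset.card_le_card fun y hy => by
            obtain ⟨i, hi, rfl⟩ := Finset.mem_image.1 hy
            simpa using hi
      _ = a v := by simp [Finset.card_sigma]
  refine ⟨fun i => (e i).1.1, fun i => (f (e i)).1, fun i => (hfr (e i)).2, fun v => ?_⟩
  by_cases hv : v ∈ C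
  · have h0 : Finset.card {i | (f (e i)).1 = v} = 0 := by
      rw [Finset.card_eq_zero, Finset.filter_eq_empty_iff]
      rintro i - rfl
      exact (hfr (e i)).1 hv
    rw [h0, add_zero]
    exact hfib (fun i => (e i).1) (Subtype.val_injective.comp e.injective) v
  · have h0 : Finset.card {i | (e i).1.1 = v} = 0 := by
      rw [Finset.card_eq_zero, Finset.filter_eq_empty_iff]
      rintro i - rfl
      exact hv (e i).2
    rw [h0, zero_add]
    exact hfib (fun i => f (e i)) (hf.comp e.injective) v

/-- Each step has an end in the cover; `dropLast` lists the starting points of the steps and `tail`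
their end points. -/
theorem Walk.length_le_countP_support {V : Type*} {G : SimpleGraph V} {P : V → Bool}
    (hP : ∀ u v, G.Adj u v → P u ∨ P v) {u v : V} (p : G.Walk u v) :
    p.length ≤ p.support.tail.countP P + p.support.dropLast.countP P := by
  induction p with
  | nil => simp
  | @cons u v w h p ih =>
    have h1 : p.support.countP P = p.support.tail.countP P + if P v then 1 else 0 := by
      conv_lhs => rw [← p.cons_tail_support, List.countP_cons]
    rw [Walk.length_cons, Walk.support_cons, List.tail_cons,
      List.dropLast_cons_of_ne_nil p.support_ne_nil, List.countP_cons, h1]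
    rcases hP u v h with h | h <;> simp only [h, if_true] <;> omega

theorem Walk.length_le_two_mul_countP_tail_support {V : Type*} {G : SimpleGraph V} {P : V → Bool}
    (hP : ∀ u v, G.Adj u v → P u ∨ P v) {u : V} (p : G.Walk u u) :
    p.length ≤ 2 * p.support.tail.countP P := by
  have h := p.length_le_countP_support hP
  have h1 : p.support.countP P = p.support.tail.countP P + if P u then 1 else 0 := by
    conv_lhs => rw [← p.cons_tail_support, List.countP_cons]
  have h2 : p.support.countP P = p.support.dropLast.countP P + if P u then 1 else 0 := by
    conv_lhs => rw [← List.dropLast_append_getLast p.support_ne_nil, List.countP_append,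
      p.getLast_support, List.countP_singleton]
  omega

end SimpleGraph

/-! ### Edge ideals and their minimal primes. -/

namespace WeightedOrientedGraph

open MvPolynomial

section EdgeIdeal

variable {V K : Type*} [Field K] {D : WeightedOrientedGraph V}

theorem underlyingGraph_adj {u v : V} :
    D.underlyingGraph.Adj u v ↔ D.Adj u v ∨ D.Adj v u := by
  simp only [underlyingGraph, Digraph.toSimpleGraphInclusive, SimpleGraph.fromRel_adj]
  refine ⟨fun h => h.2, fun h => ⟨?_, h⟩⟩
  rintro rfl
  exact h.elim (fun h => D.asymm _ _ h h) fun h => D.asymm _ _ h h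

theorem X_mul_X_pow_mem_edgeIdeal {u v : V} (h : D.Adj u v) :
    (X u * X v ^ D.weight v : MvPolynomial V K) ∈ D.edgeIdeal K :=
  Ideal.subset_span ⟨u, v, h, rfl⟩

theorem X_mul_X_pow_eq_monomial (u v : V) (k : ℕ) :
    (X u * X v ^ k : MvPolynomial V K) =
      monomial (Finsupp.single u 1 + Finsupp.single v k) 1 := by
  rw [X_pow_eq_monomial, X, monomial_mul, one_mul]

theorem edgeIdeal_eq_span_monomial : D.edgeIdeal K =
    Ideal.span ((fun e => monomial e (1 : K)) '' {e | ∃ u v, D.Adj u v ∧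
      e = Finsupp.single u 1 + Finsupp.single v (D.weight v)}) := by
  refine congrArg Ideal.span (Set.ext fun f => ?_)
  constructor
  · rintro ⟨u, v, h, rfl⟩
    exact ⟨_, ⟨u, v, h, rfl⟩, (X_mul_X_pow_eq_monomial u v _).symm⟩
  · rintro ⟨_, ⟨u, v, h, rfl⟩, rfl⟩
    exact ⟨u, v, h, (X_mul_X_pow_eq_monomial u v _).symm⟩

/-- An induction principle for exponents occurring in `I ^ n`, applied both to gradings and to the
floor sums over covers. -/
theorem forall_mem_support_of_mem_edgeIdeal_pow {Q : ℕ → (V →₀ ℕ) → Prop} (h0 : ∀ m, Q 0 m)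
    (hmono : ∀ n, Monotone (Q n))
    (hstep : ∀ n m u v, D.Adj u v → Q n m →
      Q (n + 1) (m + (Finsupp.single u 1 + Finsupp.single v (D.weight v))))
    {n : ℕ} {f : MvPolynomial V K} (hf : f ∈ D.edgeIdeal K ^ n) : ∀ m ∈ f.support, Q n m := by
  classical
  induction n generalizing f with
  | zero => exact fun m _ => h0 m
  | succ n ih =>
    rw [pow_succ] at hf
    refine Submodule.mul_induction_on hf (fun a ha b hb m hm => ?_) fun a b ha hb m hm => ?_
    · obtain ⟨x, hx, y, hy, rfl⟩ := Finset.mem_add.1 (support_mul a b hm)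
      rw [edgeIdeal_eq_span_monomial, mem_ideal_span_monomial_image] at hb
      obtain ⟨_, ⟨u, v, huv, rfl⟩, hle⟩ := hb y hy
      exact hmono _ (add_le_add_right hle x) (hstep n x u v huv (ih ha x hx))
    · rcases Finset.mem_union.1 (support_add hm) with h | h
      exacts [ha m h, hb m h]

theorem le_weight_of_mem_edgeIdeal_pow (φ : V → ℕ) (M : ℕ)
    (hφ : ∀ u v, D.Adj u v → M ≤ φ u + D.weight v * φ v) {n : ℕ} {m : V →₀ ℕ}
    (hm : monomial m (1 : K) ∈ D.edgeIdeal K ^ n) : n * M ≤ Finsupp.weight φ m := by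
  classical
  refine forall_mem_support_of_mem_edgeIdeal_pow (Q := fun n m => n * M ≤ Finsupp.weight φ m)
    (fun m => by simp) (fun n a b hab => ?_) (fun n m u v huv hm => ?_) hm m
    (by simp [support_monomial])
  · obtain ⟨c, rfl⟩ := le_iff_exists_add.1 hab
    intro h
    rw [map_add]
    exact le_add_right h
  · have := hφ u v huv
    simp only [map_add, Finsupp.weight_single, smul_eq_mul, one_mul]
    rw [add_mul, one_mul]
    exact add_le_add hm this

variable {P : Ideal (MvPolynomial V K)}

theorem mem_or_mem_of_adj (hP : P.IsPrime) (hI : D.edgeIdeal K ≤ P) {u v : V}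
    (h : D.Adj u v) : (X u : MvPolynomial V K) ∈ P ∨ (X v : MvPolynomial V K) ∈ P :=
  (hP.mem_or_mem (hI (X_mul_X_pow_mem_edgeIdeal h))).imp_right fun h' => hP.mem_of_pow_mem _ h'

theorem edgeIdeal_le_span_X_image {C : Set V} (hC : ∀ u v, D.Adj u v → u ∈ C ∨ v ∈ C) :
    D.edgeIdeal K ≤ Ideal.span (X '' C) := by
  refine Ideal.span_le.2 ?_
  rintro _ ⟨u, v, h, rfl⟩
  rcases hC u v h with h | h
  · exact Ideal.mul_mem_right _ _ (Ideal.subset_span ⟨u, h, rfl⟩)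
  · exact Ideal.mul_mem_left _ _
      (Ideal.pow_mem_of_mem _ (Ideal.subset_span (Set.mem_image_of_mem X h)) _ (D.weight_pos v))

theorem eq_span_of_mem_minimalPrimes (hP : P ∈ (D.edgeIdeal K).minimalPrimes) :
    P = Ideal.span (X '' {i | (X i : MvPolynomial V K) ∈ P}) := by
  have hle : Ideal.span (X '' {i | (X i : MvPolynomial V K) ∈ P}) ≤ P := by
    refine Ideal.span_le.2 ?_
    rintro _ ⟨i, hi, rfl⟩
    exact hi
  exact le_antisymm (hP.2 ⟨isPrime_span_X_image _, edgeIdeal_le_span_X_image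
    (C := {i | (X i : MvPolynomial V K) ∈ P}) fun u v h => mem_or_mem_of_adj hP.1.1 hP.1.2 h⟩
    hle) hle

/-- Otherwise `i` could be dropped from the vertex cover belonging to `P`. -/
theorem exists_adj_notMem_of_mem_minimalPrimes (hP : P ∈ (D.edgeIdeal K).minimalPrimes) {i : V}
    (hi : (X i : MvPolynomial V K) ∈ P) :
    ∃ j, (D.Adj i j ∨ D.Adj j i) ∧ (X j : MvPolynomial V K) ∉ P := by
  by_contra! hc
  have hle : Ideal.span (X '' ({j | (X j : MvPolynomial V K) ∈ P} \ {i})) ≤ P := by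
    refine Ideal.span_le.2 ?_
    rintro _ ⟨j, hj, rfl⟩
    exact hj.1
  have hmem := hP.2 ⟨isPrime_span_X_image _, edgeIdeal_le_span_X_image
    (C := {j | (X j : MvPolynomial V K) ∈ P} \ {i}) fun u v h => ?_⟩ hle hi
  · rw [mem_ideal_span_X_image] at hmem
    obtain ⟨j, hj, hj0⟩ := hmem (Finsupp.single i 1) (by simp [support_X])
    exact hj0 (Finsupp.single_eq_of_ne hj.2)
  · by_cases hu : u = i
    · subst hu
      exact Or.inr ⟨hc v (Or.inl h), fun hv => D.asymm _ _ h (hv ▸ h)⟩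
    · by_cases hv : v = i
      · subst hv
        exact Or.inl ⟨hc u (Or.inr h), hu⟩
      · exact (mem_or_mem_of_adj hP.1.1 hP.1.2 h).imp (fun h => ⟨h, hu⟩) fun h => ⟨h, hv⟩

/-! ### Orders at minimal primes, and monomials separating symbolic from ordinary powers. -/

section Saturation

/-- `D.SatMem P n f` says that `f` lies in the contraction of `I(D) ^ n S_P`. -/
def SatMem (D : WeightedOrientedGraph V) (P : Ideal (MvPolynomial V K)) (n : ℕ)
    (f : MvPolynomial V K) : Prop :=
  ∃ s ∉ P, s * f ∈ D.edgeIdeal K ^ n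

theorem SatMem.mul (hP : P.IsPrime) {n k : ℕ} {f g : MvPolynomial V K} (hf : D.SatMem P n f)
    (hg : D.SatMem P k g) : D.SatMem P (n + k) (f * g) := by
  obtain ⟨s, hs, hsf⟩ := hf
  obtain ⟨t, ht, htg⟩ := hg
  refine ⟨s * t, fun h => (hP.mem_or_mem h).elim hs ht, ?_⟩
  rw [mul_mul_mul_comm, pow_add]
  exact Ideal.mul_mem_mul hsf htg

theorem SatMem.zero (hP : P.IsPrime) (f : MvPolynomial V K) : D.SatMem P 0 f :=
  ⟨1, fun h => hP.ne_top ((Ideal.eq_top_iff_one P).2 h), by simp⟩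

theorem SatMem.mul_left (hP : P.IsPrime) {n : ℕ} {f : MvPolynomial V K} (hf : D.SatMem P n f)
    (g : MvPolynomial V K) : D.SatMem P n (g * f) := by
  simpa using (SatMem.zero hP g).mul hP hf

theorem SatMem.mul_right (hP : P.IsPrime) {n : ℕ} {f : MvPolynomial V K} (hf : D.SatMem P n f)
    (g : MvPolynomial V K) : D.SatMem P n (f * g) := by
  simpa using hf.mul hP (SatMem.zero hP g)

theorem SatMem.pow (hP : P.IsPrime) {n : ℕ} {f : MvPolynomial V K} (hf : D.SatMem P n f) (k : ℕ) :
    D.SatMem P (k * n) (f ^ k) := by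
  induction k with
  | zero => simpa using SatMem.zero hP _
  | succ k ih => rw [pow_succ, add_mul, one_mul]; exact ih.mul hP hf

theorem SatMem.mono {n k : ℕ} (hnk : k ≤ n) {f : MvPolynomial V K} (hf : D.SatMem P n f) :
    D.SatMem P k f :=
  let ⟨s, hs, hsf⟩ := hf
  ⟨s, hs, Ideal.pow_le_pow_right hnk hsf⟩

theorem satMem_one_of_adj (hP : P.IsPrime) {u v : V} (h : D.Adj u v)
    (hv : (X v : MvPolynomial V K) ∉ P) : D.SatMem P 1 (X u : MvPolynomial V K) :=
  ⟨X v ^ D.weight v, fun h => hv (hP.mem_of_pow_mem _ h), by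
    rw [pow_one, mul_comm]; exact X_mul_X_pow_mem_edgeIdeal h⟩

/-- Some neighbour of `i` lies outside `P` and becomes a unit in the localization. -/
theorem satMem_one_of_mem_minimalPrimes (hP : P ∈ (D.edgeIdeal K).minimalPrimes) {i : V}
    (hi : (X i : MvPolynomial V K) ∈ P) :
    D.SatMem P 1 (X i ^ D.weight i : MvPolynomial V K) := by
  obtain ⟨j, hij | hji, hj⟩ := exists_adj_notMem_of_mem_minimalPrimes hP hi
  · obtain ⟨k, hk⟩ := Nat.exists_eq_succ_of_ne_zero (D.weight_pos i).ne'
    rw [hk, pow_succ]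
    exact (satMem_one_of_adj hP.1.1 hij hj).mul_left hP.1.1 _
  · exact ⟨X j, hj, by rw [pow_one]; exact X_mul_X_pow_mem_edgeIdeal hji⟩

theorem mem_minimalSymbolicPower_iff_satMem {n : ℕ} {f : MvPolynomial V K} :
    f ∈ (D.edgeIdeal K).minimalSymbolicPower n ↔
      ∀ P ∈ (D.edgeIdeal K).minimalPrimes, D.SatMem P n f :=
  Ideal.mem_minimalSymbolicPower

theorem X_mul_X_pow_mul_X_pow_mem_minimalSymbolicPower {u v x : V} (huv : D.Adj u v)
    (hvx : D.Adj v x) :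
    (X u * X v ^ D.weight v * X x ^ (D.weight x * (D.weight v - 1)) : MvPolynomial V K) ∈
      (D.edgeIdeal K).minimalSymbolicPower (D.weight v) := by
  rw [mem_minimalSymbolicPower_iff_satMem]
  intro P hP
  have hP' := hP.1.1
  have hpos := D.weight_pos v
  by_cases hv : (X v : MvPolynomial V K) ∈ P
  · by_cases hx : (X x : MvPolynomial V K) ∈ P
    · have h1 := (satMem_one_of_mem_minimalPrimes hP hv).mul_left hP' (X u)
      have h2 := (satMem_one_of_mem_minimalPrimes hP hx).pow hP' (D.weight v - 1)
      rw [← pow_mul] at h2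
      exact (h1.mul hP' h2).mono (by omega)
    · have h1 := (satMem_one_of_adj hP' hvx hx).pow hP' (D.weight v)
      rw [mul_one] at h1
      exact (h1.mul_left hP' _).mul_right hP' _
  · have hx := (mem_or_mem_of_adj hP' hP.1.2 hvx).resolve_left hv
    have h1 := (satMem_one_of_adj hP' huv hv).mul_right hP' (X v ^ D.weight v)
    have h2 := (satMem_one_of_mem_minimalPrimes hP hx).pow hP' (D.weight v - 1)
    rw [← pow_mul] at h2
    exact (h1.mul hP' h2).mono (by omega)

theorem X_mul_X_pow_mul_X_pow_notMem_pow {u v x : V} (huv : D.Adj u v) (hvx : D.Adj v x)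
    (hv : 1 < D.weight v) :
    (X u * X v ^ D.weight v * X x ^ (D.weight x * (D.weight v - 1)) : MvPolynomial V K) ∉
      D.edgeIdeal K ^ D.weight v := by
  classical
  intro hmem
  have hne : ∀ {a b}, D.Adj a b → a ≠ b := fun h hab => D.asymm _ _ h (hab ▸ h)
  have hu_v := hne huv
  have hv_x := hne hvx
  have hu_x : u ≠ x := by rintro rfl; exact D.asymm _ _ huv hvx
  obtain ⟨k, hk⟩ := Nat.exists_eq_add_of_lt hv
  obtain ⟨l, hl⟩ := Nat.exists_eq_add_of_lt (D.weight_pos x)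
  set w := D.weight v with hw
  set y := D.weight x with hy
  -- Both generators on the path get degree exactly `1 + w * y`, and no generator gets less. The
  -- monomial has degree `1 + w * w * y`, below the required `w * (1 + w * y)` because `w > 1`.
  let φ : V → ℕ := fun i => if i = u then 1 + w * y - w else if i = v then 1 else
    if i = x then w else 1 + w * y
  have hwy : w ≤ w * y := Nat.le_mul_of_pos_right _ (D.weight_pos x)
  have hφu : φ u = 1 + w * y - w := by simp [φ]
  have hφv : φ v = 1 := by simp [φ, hu_v.symm]
  have hφx : φ x = w := by simp [φ, hu_x.symm, hv_x.symm]
  have hφo : ∀ i, i ≠ u → i ≠ v → i ≠ x → φ i = 1 + w * y := fun i h1 h2 h3 => by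
    simp [φ, h1, h2, h3]
  have hφ : ∀ a b, D.Adj a b → 1 + w * y ≤ φ a + D.weight b * φ b := by
    intro a b hab
    have hb : φ b ≤ D.weight b * φ b := Nat.le_mul_of_pos_left _ (D.weight_pos b)
    by_cases ha : a ≠ u ∧ a ≠ v ∧ a ≠ x
    · rw [hφo a ha.1 ha.2.1 ha.2.2]; omega
    by_cases hb' : b ≠ u ∧ b ≠ v ∧ b ≠ x
    · have := hφo b hb'.1 hb'.2.1 hb'.2.2; omega
    have ha3 : a = u ∨ a = v ∨ a = x := by tauto
    have hb3 : b = u ∨ b = v ∨ b = x := by tauto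
    have hcomm : y * w = w * y := mul_comm _ _
    rcases ha3 with rfl | rfl | rfl <;> rcases hb3 with rfl | rfl | rfl
    · exact absurd rfl (hne hab)
    · rw [hφu, hφv, ← hw]; omega
    · rw [hφu, hφx, ← hy]; omega
    · exact absurd hab (D.asymm _ _ huv)
    · exact absurd rfl (hne hab)
    · rw [hφv, hφx, ← hy]; omega
    · rw [hφx]; omega
    · exact absurd hab (D.asymm _ _ hvx)
    · exact absurd rfl (hne hab)
  have hmon : (X u * X v ^ w * X x ^ (y * (w - 1)) : MvPolynomial V K) =
      monomial (Finsupp.single u 1 + Finsupp.single v w + Finsupp.single x (y * (w - 1))) 1 := by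
    rw [X_mul_X_pow_eq_monomial, X_pow_eq_monomial, monomial_mul, one_mul]
  rw [hmon] at hmem
  have := le_weight_of_mem_edgeIdeal_pow φ _ hφ hmem
  simp only [map_add, Finsupp.weight_single, smul_eq_mul, hφu, hφv, hφx, one_mul, mul_one] at this
  have hw2 : w - 1 = k + 1 := by omega
  have hu' : 1 + w * y - w + w = 1 + w * y := by omega
  rw [hu', hw2] at this
  rw [hk, hl] at this
  nlinarith

theorem satMem_countP_prod (hP : P ∈ (D.edgeIdeal K).minimalPrimes) (p : V → Bool)
    (hp : ∀ i, p i → (X i : MvPolynomial V K) ∈ P) (l : List V) :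
    D.SatMem P (l.countP p) (l.map fun i => (X i ^ D.weight i : MvPolynomial V K)).prod := by
  induction l with
  | nil => exact SatMem.zero hP.1.1 _
  | cons i l ih =>
    rw [List.map_cons, List.prod_cons, List.countP_cons]
    split_ifs with hi
    · rw [add_comm]
      exact (satMem_one_of_mem_minimalPrimes hP (hp i hi)).mul hP.1.1 ih
    · exact ih.mul_left hP.1.1 _

theorem prod_support_mem_minimalSymbolicPower {z : V} (p : D.underlyingGraph.Walk z z) :
    (p.support.tail.map fun i => (X i ^ D.weight i : MvPolynomial V K)).prod ∈
      (D.edgeIdeal K).minimalSymbolicPower ((p.length + 1) / 2) := by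
  classical
  rw [mem_minimalSymbolicPower_iff_satMem]
  intro P hP
  have h := p.length_le_two_mul_countP_tail_support
    (P := fun i => decide ((X i : MvPolynomial V K) ∈ P)) fun u v huv => by
      simp only [decide_eq_true_eq]
      rcases underlyingGraph_adj.1 huv with h | h
      · exact mem_or_mem_of_adj hP.1.1 hP.1.2 h
      · exact (mem_or_mem_of_adj hP.1.1 hP.1.2 h).symm
  exact (satMem_countP_prod hP (fun i => decide ((X i : MvPolynomial V K) ∈ P))
    (fun i hi => by simpa using hi) _).mono (by omega)

end Saturation

theorem le_length_of_prod_mem_pow [Finite V] (hD : ∀ v, 1 < D.weight v → D.IsSink v) {l : List V}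
    {n : ℕ} (h : (l.map fun i => (X i ^ D.weight i : MvPolynomial V K)).prod ∈
      D.edgeIdeal K ^ n) : 2 * n ≤ l.length := by
  classical
  have := Fintype.ofFinite V
  -- An integral form of the grading `1 / w_i`: each `t_i^(w_i)` gets degree `W`, and each generator
  -- `2 * W`.
  let W := ∏ i, D.weight i
  have hW : 0 < W := Finset.prod_pos fun i _ => D.weight_pos i
  have hdvd : ∀ i, D.weight i * (W / D.weight i) = W := fun i =>
    Nat.mul_div_cancel' (Finset.dvd_prod_of_mem _ (Finset.mem_univ i))
  have hmon : (l.map fun i => (X i ^ D.weight i : MvPolynomial V K)).prod =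
      monomial (l.map fun i => Finsupp.single i (D.weight i)).sum 1 := by
    clear h
    induction l with
    | nil => simp
    | cons i l ih =>
      rw [List.map_cons, List.prod_cons, ih, X_pow_eq_monomial, monomial_mul, one_mul,
        List.map_cons, List.sum_cons]
  have hwt : Finsupp.weight (fun i => W / D.weight i)
      (l.map fun i => Finsupp.single i (D.weight i)).sum = l.length * W := by
    clear h hmon
    induction l with
    | nil => simp
    | cons i l ih =>
      rw [List.map_cons, List.sum_cons, map_add, ih, Finsupp.weight_single, smul_eq_mul, hdvd,
        List.length_cons]
      ring
  rw [hmon] at h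
  have hle := le_weight_of_mem_edgeIdeal_pow (fun i => W / D.weight i) (2 * W) (fun u v huv => by
    have hu : D.weight u = 1 := by
      by_contra hu
      have := D.weight_pos u
      exact hD u (by omega) v huv
    rw [hdvd, hu, Nat.div_one, two_mul]) h
  rw [hwt] at hle
  exact Nat.le_of_mul_le_mul_right (by linarith) hW

theorem isSink_and_isBipartite_of_pow_eq_minimalSymbolicPower [Finite V]
    (hsource : ∀ v : V, D.IsSource v → D.weight v = 1)
    (h : ∀ n : ℕ, 1 ≤ n → D.edgeIdeal K ^ n = (D.edgeIdeal K).minimalSymbolicPower n) :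
    (∀ v : V, 1 < D.weight v → D.IsSink v) ∧ D.underlyingGraph.IsBipartite := by
  have hsink : ∀ v : V, 1 < D.weight v → D.IsSink v := by
    intro v hv x hvx
    have hns : ¬ D.IsSource v := fun hs => by have := hsource v hs; omega
    rw [IsSource] at hns
    push Not at hns
    obtain ⟨u, huv⟩ := hns
    refine X_mul_X_pow_mul_X_pow_notMem_pow (K := K) huv hvx hv ?_
    rw [h _ (D.weight_pos v)]
    exact X_mul_X_pow_mul_X_pow_mem_minimalSymbolicPower huv hvx
  refine ⟨hsink, SimpleGraph.two_colorable_iff_forall_loop_even.2 fun z p => ?_⟩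
  by_contra hodd
  rw [Nat.not_even_iff_odd] at hodd
  obtain ⟨k, hk⟩ := hodd
  have hmem := prod_support_mem_minimalSymbolicPower (K := K) p
  rw [← h _ (by omega)] at hmem
  have := le_length_of_prod_mem_pow hsink hmem
  rw [List.length_tail, SimpleGraph.Walk.length_support] at this
  omega

/-! ### Bipartite graphs whose vertices of weight greater than 1 are sinks. -/

theorem X_pow_mul_X_pow_mem_edgeIdeal (hD : ∀ v, 1 < D.weight v → D.IsSink v) {u v : V}
    (h : D.underlyingGraph.Adj u v) :
    (X u ^ D.weight u * X v ^ D.weight v : MvPolynomial V K) ∈ D.edgeIdeal K := by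
  have key : ∀ {u v}, D.Adj u v →
      (X u ^ D.weight u * X v ^ D.weight v : MvPolynomial V K) ∈ D.edgeIdeal K := by
    intro u v h
    have hu : D.weight u = 1 := by
      by_contra hu
      have := D.weight_pos u
      exact hD u (by omega) v h
    rw [hu, pow_one]
    exact X_mul_X_pow_mem_edgeIdeal h
  rcases underlyingGraph_adj.1 h with h | h
  · exact key h
  · rw [mul_comm]; exact key h

theorem monomial_mem_edgeIdeal_pow [Fintype V] (hD : ∀ v, 1 < D.weight v → D.IsSink v)
    (hG : D.underlyingGraph.IsBipartite) {n : ℕ} {m : V →₀ ℕ}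
    (hm : ∀ C : Finset V, (∀ u v, D.Adj u v → u ∈ C ∨ v ∈ C) → n ≤ ∑ v ∈ C, m v / D.weight v)
    (c : K) : monomial m c ∈ D.edgeIdeal K ^ n := by
  classical
  obtain ⟨p, q, hadj, hdeg⟩ := hG.exists_edges_of_forall_le_sum_cover (fun v => m v / D.weight v) n
    fun C hC => hm C fun u v h => hC u v (underlyingGraph_adj.2 (Or.inl h))
  have hprod : ∏ i : Fin n, (X (p i) ^ D.weight (p i) * X (q i) ^ D.weight (q i) :
      MvPolynomial V K) ∈ D.edgeIdeal K ^ n := by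
    have := Ideal.prod_mem_prod (s := Finset.univ) (I := fun _ : Fin n => D.edgeIdeal K)
      fun i _ => X_pow_mul_X_pow_mem_edgeIdeal (K := K) hD (hadj i)
    simpa using this
  let e : V →₀ ℕ := ∑ i : Fin n,
    (Finsupp.single (p i) (D.weight (p i)) + Finsupp.single (q i) (D.weight (q i)))
  have hmon : ∏ i : Fin n, (X (p i) ^ D.weight (p i) * X (q i) ^ D.weight (q i) :
      MvPolynomial V K) = monomial e 1 := by
    simp only [e, X_pow_eq_monomial, monomial_mul, one_mul]
    exact (monomial_sum_one _ _).symm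
  have hle : e ≤ m := by
    intro v
    have hev : e v = D.weight v *
        (Finset.card {i | p i = v} + Finset.card {i | q i = v}) := by
      simp only [e, Finsupp.finsetSum_apply, Finsupp.add_apply, Finset.sum_add_distrib, mul_add,
        Finset.card_filter, Finset.mul_sum]
      congr 1 <;> refine Finset.sum_congr rfl fun i _ => ?_
      · by_cases h : p i = v
        · subst h; simp
        · simp [h, Finsupp.single_eq_of_ne' h]
      · by_cases h : q i = v
        · subst h; simp
        · simp [h, Finsupp.single_eq_of_ne' h]
    rw [hev]
    exact (Nat.mul_le_mul_left _ (hdeg v)).trans (Nat.mul_div_le _ _)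
  obtain ⟨d, rfl⟩ := le_iff_exists_add.1 hle
  rw [hmon] at hprod
  have := Ideal.mul_mem_right (monomial d c) _ hprod
  rwa [monomial_mul, one_mul] at this

/-- Each generator raises by at least 1 the floor at an end of its edge in `C`; for the tail this
uses weight 1. -/
theorem le_sum_div_of_mem_edgeIdeal_pow (hD : ∀ v, 1 < D.weight v → D.IsSink v) {C : Finset V}
    (hC : ∀ u v, D.Adj u v → u ∈ C ∨ v ∈ C) {n : ℕ} {f : MvPolynomial V K}
    (hf : f ∈ D.edgeIdeal K ^ n) : ∀ m ∈ f.support, n ≤ ∑ v ∈ C, m v / D.weight v := by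
  classical
  refine forall_mem_support_of_mem_edgeIdeal_pow
    (Q := fun n m => n ≤ ∑ v ∈ C, m v / D.weight v) (fun m => Nat.zero_le _)
    (fun n a b hab h => h.trans (Finset.sum_le_sum fun v _ => Nat.div_le_div_right (hab v)))
    (fun n m u v huv hm => ?_) hf
  have hu : D.weight u = 1 := by
    by_contra hu
    have := D.weight_pos u
    exact hD u (by omega) v huv
  set e : V →₀ ℕ := Finsupp.single u 1 + Finsupp.single v (D.weight v) with he
  have key : ∀ x ∈ C, D.weight x ≤ e x → n + 1 ≤ ∑ i ∈ C,
        (m + e) i / D.weight i := by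
    intro x hx hle
    refine Nat.lt_of_le_of_lt hm (Finset.sum_lt_sum (fun i _ => Nat.div_le_div_right ?_)
      ⟨x, hx, ?_⟩)
    · rw [Finsupp.add_apply]; exact Nat.le_add_right _ _
    · have h1 : m x + D.weight x ≤
          (m + e) x := by
        rw [Finsupp.add_apply]; exact add_le_add_right hle _
      have h2 := Nat.div_le_div_right (c := D.weight x) h1
      rw [Nat.add_div_right _ (D.weight_pos x)] at h2
      exact h2
  rcases hC u v huv with h | h
  · exact key u h (by rw [hu, he]; simp)
  · exact key v h (by simp [he])

theorem pow_eq_minimalSymbolicPower_of_isSink_of_isBipartite [Finite V]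
    (hD : ∀ v : V, 1 < D.weight v → D.IsSink v) (hG : D.underlyingGraph.IsBipartite) (n : ℕ) :
    D.edgeIdeal K ^ n = (D.edgeIdeal K).minimalSymbolicPower n := by
  classical
  have := Fintype.ofFinite V
  refine le_antisymm (Ideal.pow_le_minimalSymbolicPower _ n) fun f hf => ?_
  rw [f.as_sum]
  refine Ideal.sum_mem _ fun m hm => monomial_mem_edgeIdeal_pow hD hG (fun C hC => ?_) _
  have hCp := isPrime_span_X_image (K := K) (C : Set V)
  obtain ⟨P, hP, hPC⟩ := Ideal.exists_minimalPrimes_le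
    (edgeIdeal_le_span_X_image (K := K) (C := (C : Set V)) (by simpa using hC))
  obtain ⟨s, hs, hsf⟩ := Ideal.mem_minimalSymbolicPower.1 hf P hP
  -- The cover of a minimal prime below the ideal of `C`. The bound is proved for `C'`, whose sum is
  -- at most that of `C`; the multiplier `s ∉ P` is removed by `forall_mem_support_of_mul`.
  let C' : Finset V := {i | (X i : MvPolynomial V K) ∈ P}
  have hC'C : C' ⊆ C := by
    intro i hi
    have hi' : (X i : MvPolynomial V K) ∈ Ideal.span (X '' (C : Set V)) :=
      hPC (by simpa [C'] using hi)
    rw [mem_ideal_span_X_image] at hi'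
    obtain ⟨j, hj, hj0⟩ := hi' (Finsupp.single i 1) (by simp [support_X])
    rw [Finsupp.single_apply_ne_zero] at hj0
    exact hj0.1 ▸ hj
  have hC' : ∀ u v, D.Adj u v → u ∈ C' ∨ v ∈ C' := fun u v h => by
    simpa [C'] using mem_or_mem_of_adj hP.1.1 hP.1.2 h
  have hs' : ∃ x ∈ s.support, ∀ i ∈ C', x i = 0 := by
    rw [eq_span_of_mem_minimalPrimes hP, mem_ideal_span_X_image] at hs
    push Not at hs
    obtain ⟨x, hx, h⟩ := hs
    exact ⟨x, hx, fun i hi => h i (by simpa [C'] using hi)⟩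
  have hsum : ∀ y : V →₀ ℕ, ∑ v ∈ C', (y.filter (· ∈ (C' : Set V))) v / D.weight v =
      ∑ v ∈ C', y v / D.weight v := fun y => Finset.sum_congr rfl fun v hv => by
    rw [Finsupp.filter_apply_pos _ _ (by simpa using hv)]
  have := forall_mem_support_of_mul (C := (C' : Set V))
    (P := fun y => n ≤ ∑ v ∈ C', y v / D.weight v)
    (fun a b hab h => h.trans (Finset.sum_le_sum fun v _ => Nat.div_le_div_right (hab v)))
    (by simpa using hs') (fun k hk => by
      rw [hsum]
      exact le_sum_div_of_mem_edgeIdeal_pow hD hC' hsf k hk) m hm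
  rw [hsum] at this
  exact this.trans (Finset.sum_le_sum_of_subset hC'C)

end EdgeIdeal

end WeightedOrientedGraph

theorem corollary3p4 {V : Type*} [Finite V] (K : Type*) [Field K]
    (D : WeightedOrientedGraph V)
    (hsource : ∀ v : V, D.IsSource v → D.weight v = 1)
    (hemb : (D.edgeIdeal K).embeddedPrimes = ∅) :
    List.TFAE [
      (D.edgeIdeal K).IsNormallyTorsionFree,
      ∀ n : ℕ, 1 ≤ n → D.edgeIdeal K ^ n = (D.edgeIdeal K).minimalSymbolicPower n,
      (∀ v : V, 1 < D.weight v → D.IsSink v) ∧ D.underlyingGraph.IsBipartite] := by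
  tfae_have 1 ↔ 2 := Ideal.isNormallyTorsionFree_iff_pow_eq_minimalSymbolicPower hemb
  tfae_have 2 → 3 :=
    WeightedOrientedGraph.isSink_and_isBipartite_of_pow_eq_minimalSymbolicPower hsource
  tfae_have 3 → 2 := fun h n _ =>
    WeightedOrientedGraph.pow_eq_minimalSymbolicPower_of_isSink_of_isBipartite h.1 h.2 n
  tfae_finish
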